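/- **Definitions.** A semigroup $S$ is *inverse* if for every $x\in S$ there is a unique $x^{-1}\in S$ with $xx^{-1}x=x$ and $x^{-1}xx^{-1}=x^{-1}$. A *topological inverse semigroup* is a Hausdorff space with a continuous semigroup operation that is an inverse semigroup with continuous inversion $x\mapsto x^{-1}$. A *primitive inverse semigroup* is an inverse semigroup with more than one element in which every non-zero idempotent is minimal, for the order $e\leqslant f\iff ef=fe=e$, among the non-zero idempotents. A space is *pseudocompact* if each of its locally finite open covers is finite. "Tychonoff" means completely regular and $T_0$ (equivalently, completely regular and $T_1$), and "normal" includes $T_1$. For a group $G$ and a cardinal $\lambda\geqslant 1$, let $B_\lambda(G)=(\lambda\times G\times\lambda)\sqcup\{0\}$ with $(\alpha,a,\beta)(\gamma,b,\delta)=(\alpha,ab,\delta)$ if $\beta=\gamma$ and all other products equal to $0$. If $G$ is a topological group, a topology on $B_\lambda(G)$ makes it a *topological Brandt $\lambda$-extension of $G$ in the category of topological inverse semigroups* if $B_\lambda(G)$ is a topological inverse semigroup and for some $\alpha\in\lambda$ the map $g\mapsto(\alpha,g,\alpha)$ is a homeomorphism of $G$ onto the subspace $\{(\alpha,g,\alpha):g\in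 G\}$. The *orthogonal sum* $\sum_{i\in\mathscr I}S_i$ of semigroups $S_i$ with zeros $0_i$ is the disjoint union of $\{0\}$ and the sets $S_i\setminus\{0_i\}$, in which the product of two elements of the same $S_i$ is their product in $S_i$ if that is not $0_i$, and all other products are $0$. **Proposition 2.8.** Let $S$ be a primitive (Hausdorff) pseudocompact topological inverse semigroup which is topologically isomorphic to the orthogonal sum $\sum_{i\in\mathscr I}B_{\lambda_i}(G_i)$, carrying a topology in which each summand $B_{\lambda_i}(G_i)$ (its zero being identified with $0$) is a topological subspace, of topological Brandt $\lambda_i$-extensions $B_{\lambda_i}(G_i)$ of topological groups $G_i$ in the category of topological inverse semigroups, for some cardinals $\lambda_i\geqslant 1$. Then: (i) the space $S$ is Tychonoff if and only if for every $i\in\mathscr I$ the space of $G_i$ is Tychonoff; moreover, for every $i\in\mathscr I$, the space of $G_i$ is Tychonoff if and only if it is $T_0$; (ii) the space $S$ is normal if and only if for every $i\in\mathscr I$ the space of $G_i$ is normal. -/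

import Mathlib

open Topology

/-- A semigroup is inverse if every `x` has a unique `y` with `x y x = x` and `y x y = y`. -/
def IsInverseSemigroup (S : Type*) [Semigroup S] : Prop :=
  ∀ x : S, ∃! y : S, x * y * x = x ∧ y * x * y = y

/-- The inversion `x ↦ x⁻¹` of an inverse semigroup. -/
noncomputable def IsInverseSemigroup.inversion {S : Type*} [Semigroup S]
    (h : IsInverseSemigroup S) (x : S) : S :=
  (h x).choose

/-- Objects of the category of topological inverse semigroups: Hausdorff spaces with a continuous
semigroup operation, which is an inverse semigroup with continuous inversion. -/
structure IsTopologicalInverseSemigroup (S : Type*) [Semigroup S] [TopologicalSpace S] : Prop where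
  t2 : T2Space S
  continuous_mul : Continuous fun p : S × S => p.1 * p.2
  isInverse : IsInverseSemigroup S
  continuous_inversion : Continuous isInverse.inversion

/-- `z` is a zero of the semigroup `S`. -/
def IsZeroElement {S : Type*} [Semigroup S] (z : S) : Prop :=
  ∀ x : S, z * x = z ∧ x * z = z

/-- `e` is a non-zero idempotent, minimal for the natural order (`f ≤ e` iff `e f = f e = f`) among
the non-zero idempotents. In a semigroup without zero the words "non-zero" say nothing. -/
def IsPrimitiveIdempotent {S : Type*} [Semigroup S] (e : S) : Prop :=
  IsIdempotentElem e ∧ ¬ IsZeroElement e ∧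
    ∀ f : S, IsIdempotentElem f → ¬ IsZeroElement f → f * e = f → e * f = f → f = e

/-- Primitive inverse semigroups: non-trivial inverse semigroups all of whose non-zero idempotents
are primitive. -/
structure IsPrimitiveInverseSemigroup (S : Type*) [Semigroup S] : Prop where
  nontrivial : Nontrivial S
  isInverse : IsInverseSemigroup S
  primitive : ∀ e : S, IsIdempotentElem e → ¬ IsZeroElement e → IsPrimitiveIdempotent e

/-- A space is pseudocompact if every locally finite open cover of it is finite. -/
def IsPseudocompactSpace (X : Type*) [TopologicalSpace X] : Prop :=
  ∀ 𝒰 : Set (Set X), (∀ U ∈ 𝒰, IsOpen U) → ⋃₀ 𝒰 = Set.univ →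
    LocallyFinite (fun U : 𝒰 => (U : Set X)) → 𝒰.Finite

/-- The underlying set `(Λ × S × Λ) ⊔ {0}` of the Brandt `Λ`-extension `B_Λ(S)`. -/
inductive BrandtExtension (Λ : Type*) (S : Type*) where
  | zero : BrandtExtension Λ S
  | elem (α : Λ) (a : S) (β : Λ) : BrandtExtension Λ S

namespace BrandtExtension

open Classical in
/-- `(α, a, β) (γ, b, δ) = (α, a b, δ)` if `β = γ`, and all other products are `0`. -/
noncomputable def mul {Λ S : Type*} [Semigroup S] :
    BrandtExtension Λ S → BrandtExtension Λ S → BrandtExtension Λ S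
  | elem α a β, elem γ b δ => if β = γ then elem α (a * b) δ else zero
  | _, _ => zero

noncomputable instance {Λ S : Type*} [Semigroup S] : SemigroupWithZero (BrandtExtension Λ S) where
  mul := mul
  zero := zero
  mul_assoc x y z := by
    change mul (mul x y) z = mul x (mul y z)
    cases x <;> cases y <;> cases z <;> simp only [mul] <;> split_ifs <;>
      simp_all [mul_assoc]
  zero_mul x := by
    change mul zero x = zero
    simp [mul]
  mul_zero x := by
    change mul x zero = zero
    simp [mul]

end BrandtExtension

/-- A topology on `B_Λ(S)` making it a topological Brandt `Λ`-extension of the topological monoid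
`S` in the category of topological inverse semigroups: `B_Λ(S)` is a topological inverse semigroup,
and for some `α` the natural map `s ↦ (α, s, α)` is a homeomorphism of `S` onto the subspace
`S_{α,α}`. -/
structure IsTopologicalBrandtExtension (Λ S : Type*) [Monoid S] [TopologicalSpace S]
    [TopologicalSpace (BrandtExtension Λ S)] : Prop where
  isTopologicalInverseSemigroup : IsTopologicalInverseSemigroup (BrandtExtension Λ S)
  exists_isEmbedding : ∃ α : Λ, IsEmbedding fun s : S => BrandtExtension.elem α s α

/-- The underlying set `{0} ∪ ⋃ᵢ (Sᵢ \ {0ᵢ})` (a disjoint union) of the orthogonal sum of a family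
of semigroups with zero. -/
inductive OrthogonalSum {ι : Type*} (S : ι → Type*) [∀ i, SemigroupWithZero (S i)] where
  | zero : OrthogonalSum S
  | elem (i : ι) (s : S i) (hs : s ≠ 0) : OrthogonalSum S

namespace OrthogonalSum

variable {ι : Type*} {S : ι → Type*} [∀ i, SemigroupWithZero (S i)]

open Classical in
/-- The inclusion of the summand `Sᵢ` in the orthogonal sum; it identifies `0ᵢ` with `0`. -/
noncomputable def incl (i : ι) (s : S i) : OrthogonalSum S :=
  if hs : s = 0 then zero else elem i s hs

open Classical in
/-- The product of two elements of one summand is their product there (`0` if this is the zero of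
the summand), and all other products are `0`. -/
noncomputable def mul : OrthogonalSum S → OrthogonalSum S → OrthogonalSum S
  | elem i s _, elem j t _ => if h : j = i then incl i (s * h ▸ t) else zero
  | _, _ => zero

theorem zero_mul' (x : OrthogonalSum S) : mul zero x = zero := by
  cases x <;> rfl

theorem mul_zero' (x : OrthogonalSum S) : mul x zero = zero := by
  cases x <;> rfl

theorem incl_zero (i : ι) : incl i (0 : S i) = zero := by
  simp [incl]

theorem elem_eq_incl (i : ι) (s : S i) (hs : s ≠ 0) : elem i s hs = incl i s := by
  simp [incl, hs]

theorem incl_mul_incl (i : ι) (s t : S i) : mul (incl i s) (incl i t) = incl i (s * t) := by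
  by_cases hs : s = 0
  · simp [hs, incl_zero, zero_mul']
  by_cases ht : t = 0
  · simp [ht, incl_zero, mul_zero']
  rw [← elem_eq_incl i s hs, ← elem_eq_incl i t ht]
  simp [mul]

theorem incl_mul_incl_of_ne {i j : ι} (h : i ≠ j) (s : S i) (t : S j) :
    mul (incl i s) (incl j t) = zero := by
  by_cases hs : s = 0
  · simp [hs, incl_zero, zero_mul']
  by_cases ht : t = 0
  · simp [ht, incl_zero, mul_zero']
  rw [← elem_eq_incl i s hs, ← elem_eq_incl j t ht]
  simp [mul, h.symm]

noncomputable instance : SemigroupWithZero (OrthogonalSum S) where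
  mul := mul
  zero := zero
  mul_assoc x y z := by
    change mul (mul x y) z = mul x (mul y z)
    rcases x with _ | ⟨i, s, hs⟩
    · simp only [zero_mul']
    rcases y with _ | ⟨j, t, ht⟩
    · simp only [zero_mul', mul_zero']
    rcases z with _ | ⟨k, u, hu⟩
    · simp only [mul_zero']
    simp only [elem_eq_incl]
    by_cases hij : i = j
    · subst hij
      by_cases hik : i = k
      · subst hik
        simp only [incl_mul_incl, mul_assoc]
      · simp only [incl_mul_incl, incl_mul_incl_of_ne hik, mul_zero']
    · by_cases hjk : j = k
      · subst hjk
        simp only [incl_mul_incl, incl_mul_incl_of_ne hij, zero_mul']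
      · simp only [incl_mul_incl_of_ne hij, incl_mul_incl_of_ne hjk, zero_mul', mul_zero']
  zero_mul := zero_mul'
  mul_zero := mul_zero'

end OrthogonalSum

/-! Away from `0`, the orthogonal sum is a disjoint union of boxes `{(α, g, β) : g ∈ Gᵢ}`, each
clopen and homeomorphic to `Gᵢ`. The crux is `finite_not_box_subset`: the boxes shrink to `0`.

Pseudocompactness alone puts all but finitely many boxes inside the closure of a given neighbourhood
`V` of `0`. The closure is then removed by the group structure: an open `V` is dense in such a box,
and two dense open subsets of a group multiply onto the whole group, so the product of two
composable boxes of this kind lies in `V * V`, hence in `U` when `V * V ⊆ U`. The same argument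
makes every `Λ i` finite.

Complete regularity and normality then pass from the boxes to the whole space, since a closed set
missing `0` meets only finitely many boxes. Conversely, each `Gᵢ` is closed in `S`. -/

open Set Filter

section NullFamily

/-! Spaces which are the union of a point `z` and of clopen sets all but finitely many of which lie
in any given neighbourhood of `z`. -/

variable {X K : Type*} [TopologicalSpace X] {z : X} {C : K → Set X}

theorem exists_continuous_extend_of_isClopen {c : Set X} (hc : IsClopen c) {x : X} (hx : x ∈ c)
    [CompletelyRegularSpace c] {A : Set X} (hA : IsClosed A) (hxA : x ∉ A) :
    ∃ f : X → unitInterval, Continuous f ∧ f x = 0 ∧ EqOn f 1 A := by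
  classical
  obtain ⟨f, hf, hf0, hf1⟩ := CompletelyRegularSpace.completely_regular (⟨x, hx⟩ : c)
    (Subtype.val ⁻¹' A) (hA.preimage continuous_subtype_val) hxA
  -- The value 1 off `c` takes care of the part of `A` outside `c`; continuity holds because `c` is
  -- clopen.
  refine ⟨fun y => if h : y ∈ c then f ⟨y, h⟩ else 1, ?_, ?_, ?_⟩
  · rw [continuous_iff_continuousAt]
    intro y
    by_cases hy : y ∈ c
    · have : ContinuousOn (fun y => if h : y ∈ c then f ⟨y, h⟩ else 1) c := by
        rw [continuousOn_iff_continuous_domRestrict]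
        convert hf using 1
        ext w
        simp
      exact this.continuousAt (hc.isOpen.mem_nhds hy)
    · refine (continuousAt_const (y := (1 : unitInterval))).congr ?_
      filter_upwards [hc.compl.isOpen.mem_nhds hy] with w hw
      rw [dif_neg hw]
  · simpa [hx] using hf0
  · intro y hy
    by_cases h : y ∈ c
    · simpa [h] using hf1 (show (⟨y, h⟩ : c) ∈ _ from hy)
    · simp [h]

theorem isClopen_compl_biUnion_of_finite (hC : ∀ k, IsClopen (C k)) {s : Set K} (hs : s.Finite) :
    IsClopen (⋃ k ∈ s, C k)ᶜ :=
  (hs.isClopen_biUnion fun k _ => hC k).compl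

/-- At `z`, a closed set missing `z` meets finitely many pieces, and the indicator of their clopen
union separates. Any other point is handled inside its own piece. -/
theorem completelyRegularSpace_of_null_family (hC : ∀ k, IsClopen (C k)) (hz : ∀ k, z ∉ C k)
    (hcov : ∀ x, x = z ∨ ∃ k, x ∈ C k) (hnull : ∀ U ∈ 𝓝 z, {k | ¬ C k ⊆ U}.Finite)
    (hreg : ∀ k, CompletelyRegularSpace (C k)) : CompletelyRegularSpace X := by
  classical
  refine ⟨fun x A hA hx => ?_⟩
  rcases hcov x with rfl | ⟨k, hk⟩
  · have hfin := hnull Aᶜ (hA.isOpen_compl.mem_nhds hx)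
    have hcl := isClopen_compl_biUnion_of_finite hC hfin
    refine ⟨fun y => if y ∈ (⋃ k ∈ {k | ¬ C k ⊆ Aᶜ}, C k) then 1 else 0, ?_, ?_, ?_⟩
    · refine Continuous.if (fun y hy => ?_) continuous_const continuous_const
      have := hcl.compl.frontier_eq
      rw [compl_compl] at this
      exact absurd (this ▸ hy) (notMem_empty y)
    · simp [hz]
    · intro y hy
      have : y ∈ (⋃ k ∈ {k | ¬ C k ⊆ Aᶜ}, C k) := by
        rcases hcov y with rfl | ⟨k, hk⟩
        · exact absurd hy hx
        · exact mem_biUnion (show ¬ C k ⊆ Aᶜ from fun h => h hk hy) hk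
      simp only [if_pos this, Pi.one_apply]
  · have := hreg k
    exact exists_continuous_extend_of_isClopen (hC k) hk hA hx

theorem separatedNhds_inter_of_isClopen {c : Set X} (hc : IsClopen c) [NormalSpace c]
    {A B : Set X} (hA : IsClosed A) (hB : IsClosed B) (hAB : Disjoint A B) :
    SeparatedNhds A (B ∩ c) := by
  obtain ⟨U, V, hU, hV, hAU, hBV, hUV⟩ := NormalSpace.normal
    (Subtype.val ⁻¹' A : Set c) (Subtype.val ⁻¹' B)
    (hA.preimage continuous_subtype_val) (hB.preimage continuous_subtype_val) (hAB.preimage _)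
  refine ⟨Subtype.val '' U ∪ cᶜ, Subtype.val '' V, ?_, ?_, ?_, ?_, ?_⟩
  · exact (hc.isOpen.isOpenMap_subtype_val U hU).union hc.compl.isOpen
  · exact hc.isOpen.isOpenMap_subtype_val V hV
  · intro x hx
    by_cases h : x ∈ c
    · exact Or.inl ⟨⟨x, h⟩, hAU hx, rfl⟩
    · exact Or.inr h
  · rintro x ⟨hx, h⟩
    exact ⟨⟨x, h⟩, hBV hx, rfl⟩
  · refine disjoint_union_left.2 ⟨?_, ?_⟩
    · exact (disjoint_image_iff Subtype.val_injective).2 hUV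
    · rw [Set.disjoint_left]
      rintro x hx ⟨y, -, rfl⟩
      exact hx y.2

theorem separatedNhds_biUnion_right {A : Set X} {B : K → Set X} {s : Set K} (hs : s.Finite)
    (h : ∀ k, SeparatedNhds A (B k)) : SeparatedNhds A (⋃ k ∈ s, B k) := by
  induction s, hs using Set.Finite.induction_on with
  | empty => simp
  | insert _ _ ih =>
    rw [biUnion_insert]
    exact (h _).union_right ih

/-- Of two disjoint closed sets, one misses `z`, so finitely many pieces cover it and the separation
is done piece by piece. -/
theorem normalSpace_of_null_family (hC : ∀ k, IsClopen (C k))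
    (hcov : ∀ x, x = z ∨ ∃ k, x ∈ C k) (hnull : ∀ U ∈ 𝓝 z, {k | ¬ C k ⊆ U}.Finite)
    (hnor : ∀ k, NormalSpace (C k)) : NormalSpace X := by
  have key : ∀ A B : Set X, IsClosed A → IsClosed B → Disjoint A B → z ∉ B →
      SeparatedNhds A B := by
    intro A B hA hB hAB hzB
    refine (separatedNhds_biUnion_right (hnull Bᶜ (hB.isOpen_compl.mem_nhds hzB))
      (B := fun k => B ∩ C k) fun k => ?_).mono subset_rfl ?_
    · have := hnor k
      exact separatedNhds_inter_of_isClopen (hC k) hA hB hAB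
    · intro y hy
      rcases hcov y with rfl | ⟨k, hk⟩
      · exact absurd hy hzB
      · exact mem_biUnion (show ¬ C k ⊆ Bᶜ from fun h => h hk hy) ⟨hy, hk⟩
  refine ⟨fun A B hA hB hAB => ?_⟩
  by_cases hzB : z ∈ B
  · exact (key B A hB hA hAB.symm (disjoint_right.1 hAB hzB)).symm
  · exact key A B hA hB hAB hzB

end NullFamily

/-! ### Pseudocompactness and dense sets in groups -/

/-- In a pseudocompact space, locally finite families of distinct open sets are finite. -/
theorem IsPseudocompactSpace.finite_of_locallyFinite {X K : Type*} [TopologicalSpace X]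
    (h : IsPseudocompactSpace X) {O : K → Set X} (hO : ∀ k, IsOpen (O k))
    (hinj : Function.Injective O) (hlf : LocallyFinite O) : Finite K := by
  -- Adding the whole space yields a cover and keeps local finiteness.
  have hfin : (insert univ (range O)).Finite := by
    refine h _ ?_ ?_ ?_
    · rintro U (rfl | ⟨k, rfl⟩)
      exacts [isOpen_univ, hO k]
    · exact eq_univ_of_univ_subset (subset_sUnion_of_mem (mem_insert _ _))
    · intro x
      obtain ⟨N, hN, hNf⟩ := hlf x
      refine ⟨N, hN, Finite.of_finite_image (f := Subtype.val) ?_ Subtype.val_injective.injOn⟩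
      refine ((hNf.image O).insert univ).subset ?_
      rintro _ ⟨⟨U, rfl | ⟨k, rfl⟩⟩, hU, rfl⟩
      · exact mem_insert _ _
      · exact mem_insert_of_mem _ ⟨k, hU, rfl⟩
  have : Finite (range O) := (hfin.subset (subset_insert _ _)).to_subtype
  exact Finite.of_injective (rangeFactorization O) (fun a b hab => hinj (congrArg Subtype.val hab))

/-- The nonempty open sets `C k \ closure U` form a locally finite family: `U` misses all of them,
and `C l` meets at most the `l`-th. -/
theorem IsPseudocompactSpace.finite_not_subset_closure {X K : Type*} [TopologicalSpace X]
    (h : IsPseudocompactSpace X) {z : X} {C : K → Set X} (hC : ∀ k, IsOpen (C k))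
    (hdisj : Pairwise fun k l => Disjoint (C k) (C l))
    (hcov : ∀ x, x = z ∨ ∃ k, x ∈ C k) {U : Set X} (hU : U ∈ 𝓝 z) :
    {k | ¬ C k ⊆ closure U}.Finite := by
  have hne : ∀ k : {k | ¬ C k ⊆ closure U}, (C k \ closure U).Nonempty :=
    fun k => sdiff_nonempty.2 k.2
  have := h.finite_of_locallyFinite (O := fun k : {k | ¬ C k ⊆ closure U} => C k \ closure U)
    (fun k => (hC k).sdiff isClosed_closure) ?_ ?_
  · exact Set.toFinite _
  · intro k l hkl
    by_contra hkl'
    obtain ⟨x, hx⟩ := hne k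
    have hx' : x ∈ C l \ closure U := by
      have h : C k \ closure U = C l \ closure U := hkl
      exact h ▸ hx
    exact disjoint_left.1 (hdisj fun h => hkl' (Subtype.ext h)) hx.1 hx'.1
  · intro x
    rcases hcov x with rfl | ⟨l, hl⟩
    · refine ⟨U, hU, ?_⟩
      convert Set.finite_empty
      refine eq_empty_of_forall_notMem ?_
      rintro k ⟨y, hy, hyU⟩
      exact hy.2 (subset_closure hyU)
    · refine ⟨C l, (hC l).mem_nhds hl, Set.Subsingleton.finite ?_⟩
      have aux : ∀ k : {k | ¬ C k ⊆ closure U}, ((C k \ closure U) ∩ C l).Nonempty →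
          (k : K) = l := by
        rintro k ⟨y, hy, hyl⟩
        by_contra hk
        exact disjoint_left.1 (hdisj hk) hy.1 hyl
      intro k hk k' hk'
      exact Subtype.ext ((aux k hk).trans (aux k' hk').symm)

/-- In a topological group, two dense sets, one of them open, have product the whole group. -/
theorem exists_mul_eq_of_dense {G : Type*} [Group G] [TopologicalSpace G] [IsTopologicalGroup G]
    {A B : Set G} (hA : IsOpen A) (hA' : Dense A) (hB' : Dense B) (g : G) :
    ∃ a ∈ A, ∃ b ∈ B, a * b = g := by
  have hopen : IsOpen ((fun b : G => g * b⁻¹) ⁻¹' A) := hA.preimage (by fun_prop)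
  obtain ⟨a, ha⟩ := hA'.nonempty_iff.2 ⟨1⟩
  -- The open set of all `b` with `g * b⁻¹ ∈ A` contains `a⁻¹ * g`, so it meets `B`.
  obtain ⟨b, hb, hbB⟩ := hB'.inter_open_nonempty _ hopen ⟨a⁻¹ * g, by simpa using ha⟩
  exact ⟨g * b⁻¹, hb, b, hbB, by simp⟩

/-! ### Transport along topological isomorphisms -/

theorem IsInverseSemigroup.inversion_eq {S : Type*} [Semigroup S] (h : IsInverseSemigroup S)
    {x y : S} (h₁ : x * y * x = x) (h₂ : y * x * y = y) : h.inversion x = y :=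
  (h x).unique (h x).choose_spec.1 ⟨h₁, h₂⟩

theorem IsInverseSemigroup.of_mulEquiv {S T : Type*} [Semigroup S] [Semigroup T]
    (h : IsInverseSemigroup S) (e : S ≃* T) : IsInverseSemigroup T := by
  intro x
  obtain ⟨y, ⟨h₁, h₂⟩, hy⟩ := h (e.symm x)
  refine ⟨e y, ⟨e.symm.injective (by simpa using h₁), e.symm.injective (by simpa using h₂)⟩, ?_⟩
  rintro w ⟨hw₁, hw₂⟩
  rw [← hy (e.symm w) ⟨by rw [← map_mul, ← map_mul, hw₁], by rw [← map_mul, ← map_mul, hw₂]⟩]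
  simp

theorem IsTopologicalInverseSemigroup.of_continuousMulEquiv {S T : Type*} [Semigroup S]
    [Semigroup T] [TopologicalSpace S] [TopologicalSpace T]
    (h : IsTopologicalInverseSemigroup S) (e : S ≃ₜ* T) : IsTopologicalInverseSemigroup T where
  t2 := by
    have := h.t2
    exact e.toHomeomorph.t2Space
  continuous_mul := by
    have : (fun p : T × T => p.1 * p.2) =
        fun p : T × T => e (e.symm p.1 * e.symm p.2) := by
      ext p
      simp
    rw [this]
    exact e.continuous.comp (h.continuous_mul.comp
      ((e.symm.continuous.comp continuous_fst).prodMk (e.symm.continuous.comp continuous_snd)))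
  isInverse := h.isInverse.of_mulEquiv e.toMulEquiv
  continuous_inversion := by
    have : (h.isInverse.of_mulEquiv e.toMulEquiv).inversion =
        fun x => e (h.isInverse.inversion (e.symm x)) := by
      ext x
      obtain ⟨h₁, h₂⟩ := (h.isInverse (e.symm x)).choose_spec.1
      exact IsInverseSemigroup.inversion_eq _
        (e.symm.injective (by simpa [IsInverseSemigroup.inversion] using h₁))
        (e.symm.injective (by simpa [IsInverseSemigroup.inversion] using h₂))
    rw [this]
    exact e.continuous.comp (h.continuous_inversion.comp e.symm.continuous)

theorem IsPseudocompactSpace.of_homeomorph {X Y : Type*} [TopologicalSpace X] [TopologicalSpace Y]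
    (h : IsPseudocompactSpace X) (e : X ≃ₜ Y) : IsPseudocompactSpace Y := by
  intro 𝒰 hU hcov hlf
  refine Finite.of_finite_image (f := preimage e) (h _ ?_ ?_ ?_) e.surjective.preimage_injective.injOn
  · rintro _ ⟨U, hU', rfl⟩
    exact (hU U hU').preimage e.continuous
  · refine eq_univ_of_forall fun x => ?_
    obtain ⟨U, hU', hx⟩ := hcov.ge (mem_univ (e x))
    exact ⟨_, ⟨U, hU', rfl⟩, hx⟩
  · intro x
    obtain ⟨N, hN, hNf⟩ := hlf (e x)
    refine ⟨e ⁻¹' N, e.continuous.continuousAt hN,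
      Finite.of_finite_image (f := Subtype.val) ?_ Subtype.val_injective.injOn⟩
    refine ((hNf.image Subtype.val).image (preimage e)).subset ?_
    rintro _ ⟨⟨_, ⟨U, hU', rfl⟩⟩, ⟨y, hy, hyN⟩, rfl⟩
    exact ⟨U, ⟨⟨U, hU'⟩, ⟨e y, hy, hyN⟩, rfl⟩, rfl⟩

/-! ### Algebra of the boxes -/

namespace BrandtExtension

variable {Λ G : Type*} [Semigroup G]

theorem elem_ne_zero (α : Λ) (g : G) (β : Λ) : elem α g β ≠ 0 :=
  fun h => BrandtExtension.noConfusion rfl rfl (heq_of_eq h)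

theorem elem_mul_elem (α β δ : Λ) (g h : G) : elem α g β * elem β h δ = elem α (g * h) δ :=
  if_pos rfl

theorem elem_mul_elem_of_ne (α δ : Λ) {β γ : Λ} (hne : β ≠ γ) (g h : G) :
    elem α g β * elem γ h δ = 0 :=
  if_neg hne

end BrandtExtension

namespace OrthogonalSum

section Algebra

variable {ι : Type*} {Λ G : ι → Type*} [∀ i, Group (G i)]

/-- The element `(α, g, β)` of the `i`-th summand of an orthogonal sum of Brandt extensions. -/
noncomputable def brandt (i : ι) (α : Λ i) (g : G i) (β : Λ i) :
    OrthogonalSum fun i => BrandtExtension (Λ i) (G i) :=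
  incl i (BrandtExtension.elem α g β)

theorem brandt_eq_elem (i : ι) (α : Λ i) (g : G i) (β : Λ i) :
    brandt i α g β = elem (S := fun i => BrandtExtension (Λ i) (G i)) i
      (BrandtExtension.elem α g β) (BrandtExtension.elem_ne_zero α g β) :=
  dif_neg _

theorem brandt_ne_zero (i : ι) (α : Λ i) (g : G i) (β : Λ i) : brandt i α g β ≠ 0 := by
  rw [brandt_eq_elem]
  intro h
  cases h

theorem eq_zero_or_eq_brandt (x : OrthogonalSum fun i => BrandtExtension (Λ i) (G i)) :
    x = 0 ∨ ∃ i α g β, x = brandt i α g β := by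
  rcases x with _ | ⟨i, _ | ⟨α, g, β⟩, hs⟩
  · exact Or.inl rfl
  · exact absurd rfl hs
  · exact Or.inr ⟨i, α, g, β, (brandt_eq_elem i α g β).symm⟩

theorem brandt_inj {i : ι} {α α' β β' : Λ i} {g g' : G i}
    (h : brandt i α g β = brandt i α' g' β') : α = α' ∧ g = g' ∧ β = β' := by
  rw [brandt_eq_elem, brandt_eq_elem] at h
  simpa using h

theorem brandt_index_inj {i j : ι} {α β : Λ i} {α' β' : Λ j} {g : G i} {g' : G j}
    (h : brandt i α g β = brandt j α' g' β') : i = j := by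
  rw [brandt_eq_elem, brandt_eq_elem] at h
  injection h

theorem brandt_mul_brandt (i : ι) (α β δ : Λ i) (g h : G i) :
    brandt i α g β * brandt i β h δ = brandt i α (g * h) δ := by
  refine (incl_mul_incl i _ _).trans ?_
  rw [BrandtExtension.elem_mul_elem, brandt]

theorem brandt_mul_brandt_of_ne (i : ι) (α δ : Λ i) {β γ : Λ i} (hne : β ≠ γ) (g h : G i) :
    brandt i α g β * brandt i γ h δ = 0 := by
  refine (incl_mul_incl i _ _).trans ?_
  rw [BrandtExtension.elem_mul_elem_of_ne α δ hne]
  exact incl_zero i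

theorem brandt_mul_brandt_of_index_ne {i j : ι} (hij : i ≠ j) (α β : Λ i) (γ δ : Λ j) (g : G i)
    (h : G j) : brandt i α g β * brandt j γ h δ = 0 :=
  incl_mul_incl_of_ne hij _ _

/-- The set `{(α, g, β) : g ∈ Gᵢ}`, for `k = (i, α, β)`. -/
def box (G : ι → Type*) [∀ i, Group (G i)] (k : Σ i, Λ i × Λ i) :
    Set (OrthogonalSum fun i => BrandtExtension (Λ i) (G i)) :=
  range fun g : G k.1 => brandt k.1 k.2.1 g k.2.2

theorem zero_notMem_box (k : Σ i, Λ i × Λ i) : 0 ∉ box G k := by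
  rintro ⟨g, hg⟩
  exact brandt_ne_zero _ _ _ _ hg

theorem eq_zero_or_mem_box (x : OrthogonalSum fun i => BrandtExtension (Λ i) (G i)) :
    x = 0 ∨ ∃ k, x ∈ box G k := by
  rcases eq_zero_or_eq_brandt x with h | ⟨i, α, g, β, rfl⟩
  · exact Or.inl h
  · exact Or.inr ⟨⟨i, α, β⟩, g, rfl⟩

theorem pairwise_disjoint_box :
    Pairwise fun k l : Σ i, Λ i × Λ i => Disjoint (box G k) (box G l) := by
  rintro ⟨i, α, β⟩ ⟨j, γ, δ⟩ hkl
  rw [disjoint_left]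
  rintro _ ⟨g, rfl⟩ ⟨h, hh⟩
  obtain rfl := brandt_index_inj hh
  obtain ⟨rfl, -, rfl⟩ := brandt_inj hh
  exact hkl rfl

/-- This description shows that boxes are open. -/
theorem box_eq_setOf_mul_ne_zero (i : ι) (α β : Λ i) :
    box G ⟨i, α, β⟩ = {x | brandt i α 1 α * x * brandt i β 1 β ≠ 0} := by
  ext x
  constructor
  · rintro ⟨g, rfl⟩
    simpa only [mem_ofPred_eq, brandt_mul_brandt] using brandt_ne_zero _ _ _ _
  · intro hx
    rcases eq_zero_or_eq_brandt x with rfl | ⟨j, γ, g, δ, rfl⟩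
    · simp at hx
    · by_cases hij : i = j
      · subst hij
        by_cases hα : α = γ
        · by_cases hβ : δ = β
          · subst hα hβ
            exact ⟨g, rfl⟩
          · subst hα
            exact absurd (by rw [brandt_mul_brandt, brandt_mul_brandt_of_ne i _ _ hβ]) hx
        · exact absurd (by rw [brandt_mul_brandt_of_ne i _ _ hα, zero_mul]) hx
      · exact absurd (by rw [brandt_mul_brandt_of_index_ne hij, zero_mul]) hx

theorem inversion_brandt
    (h : IsInverseSemigroup (OrthogonalSum fun i => BrandtExtension (Λ i) (G i)))
    (i : ι) (α : Λ i) (g : G i) (β : Λ i) :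
    h.inversion (brandt i α g β) = brandt i β g⁻¹ α :=
  h.inversion_eq (by simp [brandt_mul_brandt]) (by simp [brandt_mul_brandt])

/-- This description by equations shows that boxes are closed. -/
theorem box_eq_setOf_mul_inversion
    (h : IsInverseSemigroup (OrthogonalSum fun i => BrandtExtension (Λ i) (G i)))
    (i : ι) (α β : Λ i) :
    box G ⟨i, α, β⟩ =
      {x | x * h.inversion x = brandt i α 1 α ∧ h.inversion x * x = brandt i β 1 β} := by
  ext x
  constructor
  · rintro ⟨g, rfl⟩
    simp [inversion_brandt, brandt_mul_brandt]
  · rintro ⟨h₁, h₂⟩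
    rcases eq_zero_or_eq_brandt x with rfl | ⟨j, γ, g, δ, rfl⟩
    · rw [zero_mul] at h₁
      exact absurd h₁.symm (brandt_ne_zero _ _ _ _)
    · rw [inversion_brandt, brandt_mul_brandt] at h₁ h₂
      obtain rfl := brandt_index_inj h₁
      obtain ⟨rfl, -⟩ := brandt_inj h₁
      obtain ⟨rfl, -⟩ := brandt_inj h₂
      exact ⟨g, rfl⟩

end Algebra

/-! ### Topology of the boxes -/

section Topology

variable {ι : Type*} {Λ G : ι → Type*} [∀ i, Group (G i)]
  [TopologicalSpace (OrthogonalSum fun i => BrandtExtension (Λ i) (G i))]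

theorem isClopen_box
    (h : IsTopologicalInverseSemigroup (OrthogonalSum fun i => BrandtExtension (Λ i) (G i)))
    (k : Σ i, Λ i × Λ i) : IsClopen (box G k) := by
  have := h.t2
  have : ContinuousMul (OrthogonalSum fun i => BrandtExtension (Λ i) (G i)) := ⟨h.continuous_mul⟩
  have hinv := h.continuous_inversion
  obtain ⟨i, α, β⟩ := k
  constructor
  · rw [box_eq_setOf_mul_inversion h.isInverse]
    exact (isClosed_eq (continuous_id.mul hinv) continuous_const).inter
      (isClosed_eq (hinv.mul continuous_id) continuous_const)
  · rw [box_eq_setOf_mul_ne_zero]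
    exact isOpen_ne_fun (by fun_prop) continuous_const

theorem exists_isOpen_mul_mem
    (h : IsTopologicalInverseSemigroup (OrthogonalSum fun i => BrandtExtension (Λ i) (G i)))
    {U : Set (OrthogonalSum fun i => BrandtExtension (Λ i) (G i))} (hU : U ∈ 𝓝 0) :
    ∃ V, IsOpen V ∧ 0 ∈ V ∧ ∀ x ∈ V, ∀ y ∈ V, x * y ∈ U := by
  have hU' : (fun p : (OrthogonalSum fun i => BrandtExtension (Λ i) (G i)) × _ => p.1 * p.2) ⁻¹' U
      ∈ 𝓝 ((0 : OrthogonalSum fun i => BrandtExtension (Λ i) (G i)), 0) := by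
    refine h.continuous_mul.continuousAt ?_
    simpa using hU
  obtain ⟨V, hV, h0, hVU⟩ := exists_nhds_square hU'
  exact ⟨V, hV, h0, fun x hx y hy => hVU (mk_mem_prod hx hy)⟩

variable [∀ i, TopologicalSpace (G i)] [∀ i, TopologicalSpace (BrandtExtension (Λ i) (G i))]

/-- Multiplication by suitable `(·, 1, ·)` on both sides carries any box to the one diagonal box
where the embedding is given, and back. -/
theorem isEmbedding_brandt
    (h : IsTopologicalInverseSemigroup (OrthogonalSum fun i => BrandtExtension (Λ i) (G i)))
    (hB : ∀ i, IsTopologicalBrandtExtension (Λ i) (G i))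
    (hincl : ∀ i, IsEmbedding (incl (S := fun i => BrandtExtension (Λ i) (G i)) i))
    (i : ι) (α β : Λ i) : IsEmbedding fun g : G i => brandt i α g β := by
  have : ContinuousMul (OrthogonalSum fun i => BrandtExtension (Λ i) (G i)) := ⟨h.continuous_mul⟩
  obtain ⟨γ, hγ⟩ := (hB i).exists_isEmbedding
  have h₀ : IsEmbedding fun g : G i => brandt i γ g γ := (hincl i).comp hγ
  refine IsEmbedding.of_comp ?_ (g := fun x => brandt i γ 1 α * x * brandt i β 1 γ)
    (by fun_prop) ?_
  · have : (fun g : G i => brandt i α g β) =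
        fun g => brandt i α 1 γ * brandt i γ g γ * brandt i γ 1 β := by
      ext g
      simp [brandt_mul_brandt]
    rw [this]
    exact (continuous_const.mul h₀.continuous).mul continuous_const
  · convert h₀ using 2 with g
    simp [brandt_mul_brandt]

theorem isClosedEmbedding_brandt
    (h : IsTopologicalInverseSemigroup (OrthogonalSum fun i => BrandtExtension (Λ i) (G i)))
    (hB : ∀ i, IsTopologicalBrandtExtension (Λ i) (G i))
    (hincl : ∀ i, IsEmbedding (incl (S := fun i => BrandtExtension (Λ i) (G i)) i))
    (i : ι) (α β : Λ i) : IsClosedEmbedding fun g : G i => brandt i α g β :=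
  ⟨isEmbedding_brandt h hB hincl i α β, (isClopen_box h ⟨i, α, β⟩).isClosed⟩

/-- Every box is homeomorphic to the group it is made from. -/
noncomputable def boxHomeomorph
    (h : IsTopologicalInverseSemigroup (OrthogonalSum fun i => BrandtExtension (Λ i) (G i)))
    (hB : ∀ i, IsTopologicalBrandtExtension (Λ i) (G i))
    (hincl : ∀ i, IsEmbedding (incl (S := fun i => BrandtExtension (Λ i) (G i)) i))
    (k : Σ i, Λ i × Λ i) : G k.1 ≃ₜ box G k :=
  (isEmbedding_brandt h hB hincl k.1 k.2.1 k.2.2).toHomeomorph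

variable [∀ i, IsTopologicalGroup (G i)]

/-- If two composable boxes lie in the closure of an open set `V`, their product box lies in
`V * V`. -/
theorem exists_mul_eq_brandt_of_subset_closure
    (h : IsTopologicalInverseSemigroup (OrthogonalSum fun i => BrandtExtension (Λ i) (G i)))
    (hB : ∀ i, IsTopologicalBrandtExtension (Λ i) (G i))
    (hincl : ∀ i, IsEmbedding (incl (S := fun i => BrandtExtension (Λ i) (G i)) i))
    {V : Set (OrthogonalSum fun i => BrandtExtension (Λ i) (G i))} (hV : IsOpen V)
    {i : ι} {α β γ : Λ i} (h₁ : box G ⟨i, α, γ⟩ ⊆ closure V) (h₂ : box G ⟨i, γ, β⟩ ⊆ closure V)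
    (g : G i) : ∃ x ∈ V, ∃ y ∈ V, x * y = brandt i α g β := by
  have hdense : ∀ δ ε : Λ i, box G ⟨i, δ, ε⟩ ⊆ closure V →
      Dense ((fun g : G i => brandt i δ g ε) ⁻¹' V) := by
    intro δ ε hδε
    have hopen : IsOpenEmbedding fun g : G i => brandt i δ g ε :=
      ⟨isEmbedding_brandt h hB hincl i δ ε, (isClopen_box h ⟨i, δ, ε⟩).isOpen⟩
    intro g
    -- Preimages under continuous open maps commute with closure.
    rw [← hopen.isOpenMap.preimage_closure_eq_closure_preimage hopen.continuous]
    exact hδε ⟨g, rfl⟩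
  obtain ⟨a, ha, b, hb, rfl⟩ := exists_mul_eq_of_dense
    (hV.preimage (isEmbedding_brandt h hB hincl i α γ).continuous) (hdense α γ h₁)
    (hdense γ β h₂) g
  exact ⟨_, ha, _, hb, brandt_mul_brandt i α γ β a b⟩

/-- If `Λ i` were infinite, some `γ` would have both boxes `(α, γ)` and `(γ, α)` in `closure V`, and
their product would put the idempotent `(α, 1, α)` into `V * V`, which was chosen to avoid it. -/
theorem finite_of_isPseudocompactSpace
    (h : IsTopologicalInverseSemigroup (OrthogonalSum fun i => BrandtExtension (Λ i) (G i)))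
    (hpc : IsPseudocompactSpace (OrthogonalSum fun i => BrandtExtension (Λ i) (G i)))
    (hB : ∀ i, IsTopologicalBrandtExtension (Λ i) (G i))
    (hincl : ∀ i, IsEmbedding (incl (S := fun i => BrandtExtension (Λ i) (G i)) i))
    (i : ι) : Finite (Λ i) := by
  by_contra hinf
  rw [not_finite_iff_infinite] at hinf
  obtain ⟨α⟩ : Nonempty (Λ i) := inferInstance
  have := h.t2
  obtain ⟨V, hV, h0, hVU⟩ := exists_isOpen_mul_mem h
    (isOpen_compl_singleton.mem_nhds (brandt_ne_zero i α 1 α).symm)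
  have hfin := hpc.finite_not_subset_closure (fun k => (isClopen_box (G := G) h k).isOpen)
    pairwise_disjoint_box eq_zero_or_mem_box (hV.mem_nhds h0)
  have hf₁ : {γ | ¬ box G ⟨i, α, γ⟩ ⊆ closure V}.Finite :=
    hfin.preimage (f := fun γ : Λ i => (⟨i, α, γ⟩ : Σ i, Λ i × Λ i))
      (fun a _ b _ hab => by simpa using hab)
  have hf₂ : {γ | ¬ box G ⟨i, γ, α⟩ ⊆ closure V}.Finite :=
    hfin.preimage (f := fun γ : Λ i => (⟨i, γ, α⟩ : Σ i, Λ i × Λ i))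
      (fun a _ b _ hab => by simpa using hab)
  obtain ⟨γ, hγ⟩ := (hf₁.union hf₂).exists_notMem
  simp only [mem_union, mem_ofPred_eq, not_or, not_not] at hγ
  obtain ⟨x, hx, y, hy, hxy⟩ :=
    exists_mul_eq_brandt_of_subset_closure h hB hincl hV hγ.1 hγ.2 1
  exact hVU x hx y hy hxy

/-- Every neighbourhood of zero contains all but finitely many boxes. -/
theorem finite_not_box_subset
    (h : IsTopologicalInverseSemigroup (OrthogonalSum fun i => BrandtExtension (Λ i) (G i)))
    (hpc : IsPseudocompactSpace (OrthogonalSum fun i => BrandtExtension (Λ i) (G i)))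
    (hB : ∀ i, IsTopologicalBrandtExtension (Λ i) (G i))
    (hincl : ∀ i, IsEmbedding (incl (S := fun i => BrandtExtension (Λ i) (G i)) i))
    {U : Set (OrthogonalSum fun i => BrandtExtension (Λ i) (G i))} (hU : U ∈ 𝓝 0) :
    {k | ¬ box G k ⊆ U}.Finite := by
  obtain ⟨V, hV, h0, hVU⟩ := exists_isOpen_mul_mem h hU
  have hfin := hpc.finite_not_subset_closure (fun k => (isClopen_box (G := G) h k).isOpen)
    pairwise_disjoint_box eq_zero_or_mem_box (hV.mem_nhds h0)
  have := finite_of_isPseudocompactSpace h hpc hB hincl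
  -- Only finitely many `i` own a box outside `closure V`, and each owns finitely many boxes. For
  -- any other `i`, the box `(α, β)` is the product of `(α, α)` and `(α, β)`.
  refine ((hfin.image Sigma.fst).biUnion fun i _ =>
    Set.finite_range fun p : Λ i × Λ i => (⟨i, p⟩ : Σ i, Λ i × Λ i)).subset ?_
  rintro ⟨i, α, β⟩ hk
  refine mem_biUnion (x := i) ?_ ⟨(α, β), rfl⟩
  by_contra hi
  have hgood : ∀ γ δ : Λ i, box G ⟨i, γ, δ⟩ ⊆ closure V := by
    intro γ δ
    by_contra hγδ
    exact hi ⟨_, hγδ, rfl⟩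
  refine hk ?_
  rintro _ ⟨g, rfl⟩
  obtain ⟨x, hx, y, hy, hxy⟩ :=
    exists_mul_eq_brandt_of_subset_closure h hB hincl hV (hgood α α) (hgood α β) g
  have hmem := hVU x hx y hy
  rwa [hxy] at hmem

end Topology

end OrthogonalSum

/-! ### Separation axioms -/

theorem t35Space_of_isTopologicalGroup (G : Type*) [Group G] [TopologicalSpace G]
    [IsTopologicalGroup G] [T0Space G] : T35Space G := by
  -- Complete regularity comes from the group uniformity.
  let := IsTopologicalGroup.rightUniformSpace G
  have : CompletelyRegularSpace G := inferInstance
  exact { }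

theorem proposition2p8 {S ι : Type*} {Λ G : ι → Type*}
    [Semigroup S] [TopologicalSpace S]
    (hS : IsTopologicalInverseSemigroup S) (hprim : IsPrimitiveInverseSemigroup S)
    (hpc : IsPseudocompactSpace S)
    [∀ i, Nonempty (Λ i)]
    [∀ i, Group (G i)] [∀ i, TopologicalSpace (G i)] [∀ i, IsTopologicalGroup (G i)]
    -- topologies on the Brandt extensions and on their orthogonal sum
    [∀ i, TopologicalSpace (BrandtExtension (Λ i) (G i))]
    [TopologicalSpace (OrthogonalSum fun i => BrandtExtension (Λ i) (G i))]
    (hB : ∀ i, IsTopologicalBrandtExtension (Λ i) (G i))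
    -- every summand is a subspace of the orthogonal sum
    (hincl : ∀ i, IsEmbedding
      (OrthogonalSum.incl (S := fun i => BrandtExtension (Λ i) (G i)) i))
    -- the topological isomorphism of `S` with the orthogonal sum
    (e : S ≃ₜ* OrthogonalSum fun i => BrandtExtension (Λ i) (G i)) :
    (T35Space S ↔ ∀ i, T35Space (G i)) ∧
    (∀ i, T35Space (G i) ↔ T0Space (G i)) ∧
    (T4Space S ↔ ∀ i, T4Space (G i)) := by
  have hT := hS.of_continuousMulEquiv e
  have hpcT := hpc.of_homeomorph e.toHomeomorph
  have hS2 := hS.t2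
  have hnull := fun U (hU : U ∈ 𝓝 0) =>
    OrthogonalSum.finite_not_box_subset (U := U) hT hpcT hB hincl hU
  have hclosed : ∀ i, ∃ f : G i → S, IsClosedEmbedding f := fun i =>
    have ⟨α⟩ := ‹∀ i, Nonempty (Λ i)› i
    ⟨_, e.symm.toHomeomorph.isClosedEmbedding.comp
      (OrthogonalSum.isClosedEmbedding_brandt hT hB hincl i α α)⟩
  refine ⟨⟨fun _ i => ?_, fun hG => ?_⟩, fun i => ⟨fun _ => inferInstance, fun _ => ?_⟩,
    fun _ i => ?_, fun hG => ?_⟩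
  · obtain ⟨f, hf⟩ := hclosed i
    have := hf.isEmbedding.t35Space
    exact this
  · have : CompletelyRegularSpace (OrthogonalSum fun i => BrandtExtension (Λ i) (G i)) :=
      completelyRegularSpace_of_null_family (OrthogonalSum.isClopen_box hT)
        OrthogonalSum.zero_notMem_box OrthogonalSum.eq_zero_or_mem_box hnull fun k =>
          (OrthogonalSum.boxHomeomorph hT hB hincl k).symm.isInducing.completelyRegularSpace
    have := e.toHomeomorph.isInducing.completelyRegularSpace
    exact { }
  · exact t35Space_of_isTopologicalGroup (G i)
  · obtain ⟨f, hf⟩ := hclosed i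
    exact hf.t4Space
  · have : NormalSpace (OrthogonalSum fun i => BrandtExtension (Λ i) (G i)) :=
      normalSpace_of_null_family (OrthogonalSum.isClopen_box hT)
        OrthogonalSum.eq_zero_or_mem_box hnull fun k =>
          (OrthogonalSum.boxHomeomorph hT hB hincl k).symm.isClosedEmbedding.normalSpace
    have := e.toHomeomorph.isClosedEmbedding.normalSpace
    exact { }
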